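/- **Notation.** Let $X$ be a real Banach space with closed unit ball $B_X$. Let $\mathscr B(X)$, $\mathscr C(X)$ and $\mathscr K(X)$ be the families of all nonempty bounded, all nonempty bounded closed convex, and all nonempty compact convex subsets of $X$, respectively. A *fundamental sub-semigroup* of $\mathscr C(X)$ is a family $\mathscr D\subset\mathscr C(X)$ that is stable under $(A,B)\mapsto\overline{A+B}$, closed in $\mathscr C(X)$ for the Hausdorff metric, and satisfies 1. $\bigcup_{D\in\mathscr D}D=X$; 2. $\overline{\rm co}(A\cup(-A)\cup B\cup(-B))\in\mathscr D$ for all $A,B\in\mathscr D$; 3. $\overline{\rm co}(B)\in\mathscr D$ whenever $\emptyset\ne B\subset D\in\mathscr D$. A function $\mu:\mathscr B(X)\to[0,\infty)$ is a *convex measure of non-property $\mathfrak D$* (with respect to $\mathscr D$) if, for all $A,B\in\mathscr B(X)$ and $0\le\lambda\le1$, - $\mu(B)=0\iff\overline{\rm co}(B)\in\mathscr D$, - $B\subset A\Rightarrow\mu(B)\le\mu(A)$, - $\mu({\rm co}(B))=\mu(B)$, - $\mu(\lambda A+(1-\lambda)B)\le\lambda\mu(A)+(1-\lambda)\mu(B)$.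 It is a *sublinear measure of non-property $\mathfrak D$* if the last condition is replaced by $\mu(A+B)\le\mu(A)+\mu(B)$ and $\mu(kB)=k\mu(B)$ for all $k\ge0$. Let $\Omega$ be the closed unit ball of $X^*$ with the norm topology, and let $C_b(\Omega)$ be the space of bounded continuous real functions on $\Omega$ with the sup-norm and the pointwise order. For $A\in\mathscr B(X)$ let $J(A)\in C_b(\Omega)$ be the support function $J(A)(\omega)=\sup_{a\in A}\langle\omega,a\rangle$. Put $E_{\mathscr C}=\overline{J\mathscr C(X)-J\mathscr C(X)}$ and $E_{\mathscr K}=\overline{J\mathscr K(X)-J\mathscr K(X)}$. Let $I$ be the closed lattice ideal of $E_{\mathscr C}$ generated by $E_{\mathscr K}$, that is, the smallest closed linear subspace of $E_{\mathscr C}$ that contains $E_{\mathscr K}$ and contains every $z\in E_{\mathscr C}$ with $|z|\le|y|$ for some element $y$ of the subspace. Let $Q:E_{\mathscr C}\to E_{\mathscr C}/I$ be the quotient map; the quotient carries the quotient norm and the order whose positive elements are the $Q(x)$ with $0\le x\in E_{\mathscr C}$. **Theorem 6.5.** Let $X$ be a real Banach space. Then there are a compact Hausdorff space $K$ and a linear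 order isometry $T$ of $E_{\mathscr C}/I$ onto a sublattice of $C(K)$ such that, with $$\mathbb T(B)=T\,Q\,J(\overline{\rm co}(B))\quad(B\in\mathscr B(X)),\qquad V=\mathbb T(\mathscr B(X)),$$ the set $V$ is a convex cone contained in the positive cone $C(K)^+$, and the following holds. For every fundamental sub-semigroup $\mathscr D$ of $\mathscr C(X)$ and every convex measure $\mu$ of non-property $\mathfrak D$ with respect to $\mathscr D$, there is a function $\digamma$ on $V$ satisfying i) $\mu(B)=\digamma(\mathbb T(B))$ for all $B\in\mathscr B(X)$; ii) $\digamma$ is nonnegative, convex and monotone (increasing) on $V$; iii) for all $r\ge0$, $\digamma\le b_r=\digamma(r\,\mathbb T(B_X))$ on $V\cap rB_{C(K)}$; iv) for all $r\ge0$, $\digamma$ is $c_r$-Lipschitzian on $V\cap rB_{C(K)}$, where $c_r=\digamma((1+r)\mathbb T(B_X))=\mu((1+r)B_X)$; v) if $\mu$ is moreover a sublinear measure of non-property $\mathfrak D$, one can take $c_r=\mu(B_X)$ in iv). -/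

import Mathlib

open scoped Pointwise BoundedContinuousFunction

universe u

noncomputable section

namespace NonProperty

section Sets

variable (X : Type u) [NormedAddCommGroup X] [NormedSpace ℝ X]

/-- The nonempty bounded subsets of `X`. -/
def BddSets : Set (Set X) := {B | B.Nonempty ∧ Bornology.IsBounded B}

/-- The nonempty bounded closed convex subsets of `X`. -/
def CvxSets : Set (Set X) :=
  {C | C.Nonempty ∧ Bornology.IsBounded C ∧ IsClosed C ∧ Convex ℝ C}

/-- The nonempty compact convex subsets of `X`. -/
def CptSets : Set (Set X) := {C | C.Nonempty ∧ IsCompact C ∧ Convex ℝ C}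

variable {X}

/-- The closed convex hull of a set. -/
def clco (B : Set X) : Set X := closure (convexHull ℝ B)

/-- A fundamental sub-semigroup of the semigroup of nonempty bounded closed convex subsets of `X`
(with addition `closure (A + B)`), closed for the Hausdorff metric. -/
structure IsFundamental (𝒟 : Set (Set X)) : Prop where
  subset : 𝒟 ⊆ CvxSets X
  add_mem : ∀ A ∈ 𝒟, ∀ B ∈ 𝒟, closure (A + B) ∈ 𝒟
  closed : ∀ C ∈ CvxSets X, (∀ ε > 0, ∃ D ∈ 𝒟, Metric.hausdorffDist C D < ε) → C ∈ 𝒟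
  sUnion_eq : ⋃₀ 𝒟 = Set.univ
  hull_mem : ∀ A ∈ 𝒟, ∀ B ∈ 𝒟, clco ((A ∪ -A) ∪ (B ∪ -B)) ∈ 𝒟
  sub_mem : ∀ D ∈ 𝒟, ∀ B : Set X, B.Nonempty → B ⊆ D → clco B ∈ 𝒟

/-- The properties shared by convex and sublinear measures of non-property `𝔇`: a nonnegative
function on the nonempty bounded sets (values on other sets are irrelevant), vanishing exactly on
the sets whose closed convex hull is in `𝒟`, monotone and invariant under convex hulls. -/
structure IsMNP (𝒟 : Set (Set X)) (μ : Set X → ℝ) : Prop where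
  nonneg : ∀ B ∈ BddSets X, 0 ≤ μ B
  eq_zero_iff : ∀ B ∈ BddSets X, μ B = 0 ↔ clco B ∈ 𝒟
  mono : ∀ A ∈ BddSets X, ∀ B ∈ BddSets X, B ⊆ A → μ B ≤ μ A
  convexHull_eq : ∀ B ∈ BddSets X, μ (convexHull ℝ B) = μ B

/-- Convex measures of non-property `𝔇`. -/
structure IsConvexMNP (𝒟 : Set (Set X)) (μ : Set X → ℝ) : Prop extends IsMNP 𝒟 μ where
  convex : ∀ A ∈ BddSets X, ∀ B ∈ BddSets X, ∀ t : ℝ, 0 ≤ t → t ≤ 1 →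
    μ (t • A + (1 - t) • B) ≤ t * μ A + (1 - t) * μ B

/-- Sublinear measures of non-property `𝔇`. -/
structure IsSublinearMNP (𝒟 : Set (Set X)) (μ : Set X → ℝ) : Prop extends IsMNP 𝒟 μ where
  subadd : ∀ A ∈ BddSets X, ∀ B ∈ BddSets X, μ (A + B) ≤ μ A + μ B
  pos_hom : ∀ B ∈ BddSets X, ∀ k : ℝ, 0 ≤ k → μ (k • B) = k * μ B

end Sets

section Embedding

variable (X : Type u) [NormedAddCommGroup X] [NormedSpace ℝ X]

/-- The closed unit ball of the dual space, with its norm topology. -/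
abbrev DualBall : Type u := Metric.closedBall (0 : StrongDual ℝ X) 1

variable {X}

/-- The support function `ω ↦ sup_{a ∈ A} ω a` of `A` on the dual unit ball. -/
def supportFun (A : Set X) (ω : DualBall X) : ℝ := ⨆ a : A, ω.1 a.1

lemma supportFun_le_add {A : Set X} (hA : A.Nonempty) {M : ℝ} (hM : ∀ a ∈ A, ‖a‖ ≤ M)
    (ω η : DualBall X) : supportFun A ω ≤ supportFun A η + M * dist ω η := by
  have : Nonempty A := hA.to_subtype
  refine ciSup_le fun a => ?_
  have hb : BddAbove (Set.range fun a : A => η.1 a.1) := by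
    refine ⟨‖η.1‖ * M, ?_⟩
    rintro _ ⟨b, rfl⟩
    exact (le_abs_self _).trans ((η.1.le_opNorm b.1).trans
      (mul_le_mul_of_nonneg_left (hM _ b.2) (norm_nonneg _)))
  have h1 : η.1 a.1 ≤ supportFun A η := le_ciSup hb a
  have h2 : (ω.1 - η.1) a.1 ≤ M * dist ω η := by
    refine (le_abs_self _).trans (((ω.1 - η.1).le_opNorm a.1).trans ?_)
    rw [Subtype.dist_eq, dist_eq_norm, mul_comm]
    exact mul_le_mul_of_nonneg_right (hM _ a.2) (norm_nonneg _)
  have h3 : (ω.1 - η.1) a.1 = ω.1 a.1 - η.1 a.1 := rfl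
  linarith

lemma supportFun_regular {A : Set X} (hA : A ∈ BddSets X) :
    Continuous (supportFun A) ∧ ∃ M, ∀ ω, ‖supportFun A ω‖ ≤ M := by
  obtain ⟨M, hM⟩ := hA.2.exists_norm_le
  have hM0 : 0 ≤ M := by
    obtain ⟨a, ha⟩ := hA.1
    exact (norm_nonneg a).trans (hM a ha)
  have : Nonempty A := hA.1.to_subtype
  refine ⟨(LipschitzWith.of_le_add_mul M.toNNReal fun ω η => ?_).continuous, M, fun ω => ?_⟩
  · rw [Real.coe_toNNReal _ hM0]
    exact supportFun_le_add hA.1 hM ω η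
  · let z : DualBall X := ⟨0, by simp⟩
    have hz : supportFun A z = 0 := by simp [supportFun, z]
    have hd : M * dist ω z ≤ M := by
      have h : dist ω z ≤ 1 := ω.2
      nlinarith
    have h1 := supportFun_le_add hA.1 hM ω z
    have h2 := supportFun_le_add hA.1 hM z ω
    rw [dist_comm] at h2
    rw [Real.norm_eq_abs, abs_le]
    constructor <;> linarith

open Classical in
/-- The support function of a nonempty bounded set as a bounded continuous function on the dual
ball (and `0`, by convention, for the other sets). -/
def J (A : Set X) : DualBall X →ᵇ ℝ :=
  if hA : A ∈ BddSets X then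
    BoundedContinuousFunction.ofNormedAddCommGroup (supportFun A) (supportFun_regular hA).1
      (supportFun_regular hA).2.choose (supportFun_regular hA).2.choose_spec
  else 0

lemma J_apply {A : Set X} (hA : A ∈ BddSets X) (ω : DualBall X) :
    J A ω = ⨆ a : A, ω.1 a.1 := by
  rw [J, dif_pos hA]; rfl

variable (X)

/-- The subspaces of a normed space (this only fixes the instance path to its module structure). -/
abbrev NSub (E : Type u) [NormedAddCommGroup E] [NormedSpace ℝ E] : Type u := Submodule ℝ E

/-- The closed linear span of the support functions of the bounded closed convex sets. These
support functions form a convex cone, so their span is the set of their differences. -/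
def spaceC : NSub (DualBall X →ᵇ ℝ) :=
  (Submodule.span ℝ (J '' CvxSets X)).topologicalClosure

/-- The closed linear span of the support functions of the compact convex sets, that is the
closure of the set of their differences. -/
def spaceK : NSub (DualBall X →ᵇ ℝ) :=
  (Submodule.span ℝ (J '' CptSets X)).topologicalClosure

/-- The closed lattice ideals of `spaceC X`: closed solid subspaces. -/
structure IsClosedIdeal (I : NSub (spaceC X)) : Prop where
  closed : IsClosed (I : Set (spaceC X))
  solid : ∀ y ∈ I, ∀ z : spaceC X,
    |(z : DualBall X →ᵇ ℝ)| ≤ |(y : DualBall X →ᵇ ℝ)| → z ∈ I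

/-- The closed lattice ideal of `spaceC X` generated by `spaceK X`: the smallest closed lattice ideal
containing it. (In general `spaceK X` itself is closed but not solid in `spaceC X`.) -/
def idealK : NSub (spaceC X) :=
  sInf {I | IsClosedIdeal X I ∧ ∀ z : spaceC X, (z : DualBall X →ᵇ ℝ) ∈ spaceK X → z ∈ I}

/-- The quotient of the Banach lattice `spaceC X` by the closed ideal `idealK X`, with the
quotient norm. -/
abbrev QuotientSpace : Type u := spaceC X ⧸ idealK X

variable {X}

lemma J_clco_mem (B : Set X) : J (clco B) ∈ spaceC X := by
  by_cases h : clco B ∈ BddSets X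
  · exact Submodule.le_topologicalClosure _ (Submodule.subset_span
      ⟨_, ⟨h.1, h.2, isClosed_closure, (convex_convexHull ℝ B).closure⟩, rfl⟩)
  · rw [J, dif_neg h]; exact Submodule.zero_mem _

/-- The class in the quotient of the support function of the closed convex hull of `B`. -/
def QJ (B : Set X) : QuotientSpace X := Submodule.Quotient.mk ⟨J (clco B), J_clco_mem B⟩

/-- `T` is an order isometry of the quotient Banach lattice onto a sublattice of `C(K)`. Linearity
and preservation of the norm are part of the type of `T`; the positive elements of the quotient
are the classes of the nonnegative functions in `spaceC X`. -/
structure IsOrderIsometry {K : Type u} [TopologicalSpace K] [CompactSpace K]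
    (T : QuotientSpace X →ₗᵢ[ℝ] C(K, ℝ)) : Prop where
  nonneg_iff : ∀ q : QuotientSpace X, 0 ≤ T q ↔
    ∃ x : spaceC X, 0 ≤ (x : DualBall X →ᵇ ℝ) ∧ Submodule.Quotient.mk x = q
  sup_mem : ∀ p q : QuotientSpace X, ∃ s : QuotientSpace X, T s = T p ⊔ T q
  inf_mem : ∀ p q : QuotientSpace X, ∃ s : QuotientSpace X, T s = T p ⊓ T q

/-- The mapping `B ↦ T (Q (J (clco B)))`. -/
def embT {K : Type u} [TopologicalSpace K] [CompactSpace K]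
    (T : QuotientSpace X →ₗᵢ[ℝ] C(K, ℝ)) (B : Set X) : C(K, ℝ) := T (QJ B)

/-- The image of the nonempty bounded sets under `B ↦ T (Q (J (clco B)))`. -/
def coneV {K : Type u} [TopologicalSpace K] [CompactSpace K]
    (T : QuotientSpace X →ₗᵢ[ℝ] C(K, ℝ)) : Set C(K, ℝ) := embT T '' BddSets X

/-- The closed unit ball of `X`. -/
abbrev unitBall (X : Type u) [NormedAddCommGroup X] : Set X := Metric.closedBall 0 1

end Embedding

end NonProperty

end

/-! The ideal `idealK X` is small from the viewpoint of every fundamental `𝒟`. By finite nets, `𝒟`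
contains all compact convex sets, so each element of the ideal is dominated, up to any ε > 0, by the
support function of some D ∈ `𝒟` (`exists_abs_le_of_mem_idealK`). If J A ≤ J B + z + d with z in the
ideal, Hahn–Banach separation (`subset_of_J_le`) turns this into A ⊆ co B + D + d'·ball for any d' >
d. Convexity of μ makes the summand D free (`add_le_of_mem`), whence μ A ≤ μ(co B + d'·ball)
(`le_of_J_le`).

Every claim about the function on the cone follows from this inequality. With d = 0 and d' → 0 it
gives monotonicity, hence well-definedness; with B = {0} it gives the bound on balls; with d the
quotient distance it gives the Lipschitz estimate, since μ is convex along the segment from co B to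
co B + ball.

The representation does not involve μ. Support functions turn unions into maxima, so `spaceC X` is a
vector lattice; its quotient by the ideal is evaluated on the compact space K of lattice characters
vanishing on the ideal, and a clamping argument shows that this evaluation is isometric. -/

noncomputable section

namespace NonProperty

/-! ### Stability of the bounded sets -/

section BoundedSets

variable {X : Type u} [NormedAddCommGroup X]

lemma add_mem_BddSets {A B : Set X} (hA : A ∈ BddSets X) (hB : B ∈ BddSets X) : A + B ∈ BddSets X :=
  ⟨hA.1.add hB.1, hA.2.add hB.2⟩

lemma union_mem_BddSets {A B : Set X} (hA : A ∈ BddSets X) (hB : B ∈ BddSets X) :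
    A ∪ B ∈ BddSets X :=
  ⟨hA.1.inl, hA.2.union hB.2⟩

lemma mem_BddSets_of_subset {A B : Set X} (hA : A ∈ BddSets X) (hB : B.Nonempty) (h : B ⊆ A) :
    B ∈ BddSets X :=
  ⟨hB, hA.2.subset h⟩

lemma singleton_mem_BddSets (x : X) : {x} ∈ BddSets X :=
  ⟨Set.singleton_nonempty x, Bornology.isBounded_singleton⟩

lemma unitBall_mem_BddSets : unitBall X ∈ BddSets X :=
  ⟨⟨0, by simp⟩, Metric.isBounded_closedBall⟩

end BoundedSets

/-! ### Algebra of support functions and the lattice they span -/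

section SupportFunctions

variable {X : Type u} [NormedAddCommGroup X] [NormedSpace ℝ X]

lemma smul_mem_BddSets {A : Set X} (hA : A ∈ BddSets X) (k : ℝ) : k • A ∈ BddSets X :=
  ⟨hA.1.smul_set, hA.2.smul₀ k⟩

lemma convexHull_mem_BddSets {A : Set X} (hA : A ∈ BddSets X) : convexHull ℝ A ∈ BddSets X :=
  ⟨hA.1.convexHull, isBounded_convexHull.2 hA.2⟩

lemma clco_mem_BddSets {A : Set X} (hA : A ∈ BddSets X) : clco A ∈ BddSets X :=
  ⟨(convexHull_mem_BddSets hA).1.closure, (convexHull_mem_BddSets hA).2.closure⟩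

lemma mem_BddSets_of_mem_CvxSets {A : Set X} (hA : A ∈ CvxSets X) : A ∈ BddSets X := ⟨hA.1, hA.2.1⟩

lemma mem_CvxSets_of_mem_CptSets {A : Set X} (hA : A ∈ CptSets X) : A ∈ CvxSets X :=
  ⟨hA.1, hA.2.1.isBounded, hA.2.1.isClosed, hA.2.2⟩

lemma clco_mem_CvxSets {B : Set X} (hB : B ∈ BddSets X) : clco B ∈ CvxSets X :=
  ⟨(clco_mem_BddSets hB).1, (clco_mem_BddSets hB).2, isClosed_closure,
    (convex_convexHull ℝ B).closure⟩

lemma subset_clco (B : Set X) : B ⊆ clco B := (subset_convexHull ℝ B).trans subset_closure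

lemma clco_subset {B C : Set X} (hC : C ∈ CvxSets X) (h : B ⊆ C) : clco B ⊆ C :=
  closure_minimal (convexHull_min h hC.2.2.2) hC.2.2.1

lemma mem_smul_unitBall {d : ℝ} (hd : 0 ≤ d) {x : X} : x ∈ d • unitBall X ↔ ‖x‖ ≤ d := by
  rw [smul_unitClosedBall, mem_closedBall_zero_iff, Real.norm_of_nonneg hd]

lemma le_J {A : Set X} (hA : A ∈ BddSets X) (ω : DualBall X) {a : X} (ha : a ∈ A) :
    ω.1 a ≤ J A ω := by
  rw [J_apply hA]
  obtain ⟨M, hM⟩ := hA.2.exists_norm_le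
  refine le_ciSup (f := fun a : A => ω.1 a.1) ⟨‖ω.1‖ * M, ?_⟩ ⟨a, ha⟩
  rintro _ ⟨b, rfl⟩
  exact (le_abs_self _).trans ((ω.1.le_opNorm b.1).trans
    (mul_le_mul_of_nonneg_left (hM _ b.2) (norm_nonneg _)))

lemma J_le {A : Set X} (hA : A ∈ BddSets X) {ω : DualBall X} {c : ℝ} (h : ∀ a ∈ A, ω.1 a ≤ c) :
    J A ω ≤ c := by
  rw [J_apply hA]
  have : Nonempty A := hA.1.to_subtype
  exact ciSup_le fun a => h a a.2

lemma J_mono {A B : Set X} (hA : A ∈ BddSets X) (hB : B ∈ BddSets X) (h : A ⊆ B)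
    (ω : DualBall X) : J A ω ≤ J B ω :=
  J_le hA fun _ ha => le_J hB ω (h ha)

lemma J_singleton (x : X) (ω : DualBall X) : J {x} ω = ω.1 x :=
  le_antisymm (J_le (singleton_mem_BddSets x) (by simp))
    (le_J (singleton_mem_BddSets x) ω rfl)

lemma J_clco {A : Set X} (hA : A ∈ BddSets X) : J (clco A) = J A := by
  ext ω
  refine le_antisymm (J_le (clco_mem_BddSets hA) ?_)
    (J_mono hA (clco_mem_BddSets hA) (subset_clco A) ω)
  have hc : IsClosed {a : X | ω.1 a ≤ J A ω} := isClosed_le ω.1.continuous continuous_const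
  have hv : Convex ℝ {a : X | ω.1 a ≤ J A ω} := convex_halfSpace_le ω.1.toLinearMap.isLinear _
  exact closure_minimal (convexHull_min (fun a ha => le_J hA ω ha) hv) hc

lemma J_add {A B : Set X} (hA : A ∈ BddSets X) (hB : B ∈ BddSets X) : J (A + B) = J A + J B := by
  ext ω
  refine le_antisymm (J_le (add_mem_BddSets hA hB) ?_) ?_
  · rintro _ ⟨a, ha, b, hb, rfl⟩
    simpa using add_le_add (le_J hA ω ha) (le_J hB ω hb)
  · have h : J A ω ≤ J (A + B) ω - J B ω := by
      refine J_le hA fun a ha => ?_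
      have : J B ω ≤ J (A + B) ω - ω.1 a := by
        refine J_le hB fun b hb => ?_
        have := le_J (add_mem_BddSets hA hB) ω (Set.add_mem_add ha hb)
        rw [map_add] at this
        linarith
      linarith
    simp only [BoundedContinuousFunction.coe_add, Pi.add_apply]
    linarith

lemma J_smul {A : Set X} (hA : A ∈ BddSets X) {k : ℝ} (hk : 0 ≤ k) : J (k • A) = k • J A := by
  ext ω
  change J (k • A) ω = k * J A ω
  refine le_antisymm (J_le (smul_mem_BddSets hA k) ?_) ?_
  · rintro _ ⟨a, ha, rfl⟩
    simpa using mul_le_mul_of_nonneg_left (le_J hA ω ha) hk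
  · rcases hk.eq_or_lt with rfl | hk
    · obtain ⟨a, ha⟩ := hA.1
      simpa using le_J (smul_mem_BddSets hA 0) ω (Set.smul_mem_smul_set ha)
    · rw [← le_div_iff₀' hk]
      refine J_le hA fun a ha => ?_
      rw [le_div_iff₀' hk]
      simpa using le_J (smul_mem_BddSets hA k) ω (Set.smul_mem_smul_set ha)

lemma J_union {A B : Set X} (hA : A ∈ BddSets X) (hB : B ∈ BddSets X) (ω : DualBall X) :
    J (A ∪ B) ω = max (J A ω) (J B ω) := by
  refine le_antisymm (J_le (union_mem_BddSets hA hB) ?_) (max_le ?_ ?_)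
  · rintro a (ha | ha)
    · exact (le_J hA ω ha).trans (le_max_left _ _)
    · exact (le_J hB ω ha).trans (le_max_right _ _)
  · exact J_mono hA (union_mem_BddSets hA hB) Set.subset_union_left ω
  · exact J_mono hB (union_mem_BddSets hA hB) Set.subset_union_right ω

lemma norm_le_J_unitBall (ω : DualBall X) : ‖ω.1‖ ≤ J (unitBall X) ω := by
  have hn : ∀ x : X, ‖x‖ ≤ 1 → ω.1 x ≤ J (unitBall X) ω := fun x hx =>
    le_J unitBall_mem_BddSets ω (mem_closedBall_zero_iff.2 hx)
  refine ω.1.opNorm_le_of_unit_norm (by simpa using hn 0 (by simp)) fun x hx => ?_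
  rw [Real.norm_eq_abs]
  refine abs_le'.2 ⟨hn x hx.le, ?_⟩
  simpa using hn (-x) (by simp [hx])

lemma J_mem_spaceC {A : Set X} (hA : A ∈ BddSets X) : J A ∈ spaceC X := by
  rw [← J_clco hA]
  exact J_clco_mem A

lemma exists_J_sub_J_of_mem_span {x : DualBall X →ᵇ ℝ}
    (hx : x ∈ Submodule.span ℝ (J '' CvxSets X)) :
    ∃ A ∈ BddSets X, ∃ B ∈ BddSets X, x = J A - J B := by
  induction hx using Submodule.span_induction with
  | mem x h =>
    obtain ⟨A, hA, rfl⟩ := h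
    refine ⟨A, mem_BddSets_of_mem_CvxSets hA, {0}, singleton_mem_BddSets 0, ?_⟩
    ext ω
    simp [J_singleton]
  | zero => exact ⟨{0}, singleton_mem_BddSets 0, {0}, singleton_mem_BddSets 0, by simp⟩
  | add x y _ _ hx hy =>
    obtain ⟨A, hA, B, hB, rfl⟩ := hx
    obtain ⟨C, hC, D, hD, rfl⟩ := hy
    refine ⟨A + C, add_mem_BddSets hA hC, B + D, add_mem_BddSets hB hD, ?_⟩
    rw [J_add hA hC, J_add hB hD]
    abel
  | smul c x _ hx =>
    obtain ⟨A, hA, B, hB, rfl⟩ := hx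
    rcases le_total 0 c with hc | hc
    · refine ⟨c • A, smul_mem_BddSets hA c, c • B, smul_mem_BddSets hB c, ?_⟩
      rw [J_smul hA hc, J_smul hB hc, smul_sub]
    · refine ⟨(-c) • B, smul_mem_BddSets hB _, (-c) • A, smul_mem_BddSets hA _, ?_⟩
      rw [J_smul hA (neg_nonneg.2 hc), J_smul hB (neg_nonneg.2 hc), smul_sub]
      module

/-- On differences, |J A - J B| = 2 J(A ∪ B) - J A - J B because unions give maxima; continuity of
the absolute value extends this to the closure. -/
lemma abs_mem_spaceC {x : DualBall X →ᵇ ℝ} (hx : x ∈ spaceC X) : |x| ∈ spaceC X := by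
  refine map_mem_closure (f := fun y : DualBall X →ᵇ ℝ => |y|)
    (by simp only [abs]; fun_prop) hx fun y hy => ?_
  obtain ⟨A, hA, B, hB, rfl⟩ := exists_J_sub_J_of_mem_span hy
  have h : ∀ {C : Set X}, C ∈ BddSets X → J C ∈ Submodule.span ℝ (J '' CvxSets X) := by
    intro C hC
    rw [← J_clco hC]
    exact Submodule.subset_span ⟨_, clco_mem_CvxSets hC, rfl⟩
  have key : |J A - J B| = (2 : ℝ) • J (A ∪ B) - J A - J B := by
    ext ω
    simp only [BoundedContinuousFunction.coe_abs, Pi.abs_apply, BoundedContinuousFunction.coe_sub,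
      Pi.sub_apply, BoundedContinuousFunction.coe_smul, J_union hA hB, smul_eq_mul]
    rcases le_total (J A ω) (J B ω) with hh | hh
    · rw [max_eq_right hh, abs_of_nonpos (by linarith)]; ring
    · rw [max_eq_left hh, abs_of_nonneg (by linarith)]; ring
  change |J A - J B| ∈ _
  rw [key]
  exact Submodule.sub_mem _ (Submodule.sub_mem _ (Submodule.smul_mem _ _
    (h (union_mem_BddSets hA hB))) (h hA)) (h hB)

end SupportFunctions

/-! ### Quotients of function lattices as spaces of continuous functions -/

section Representation

variable {Ω : Type u} [TopologicalSpace Ω]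

/-- The linear lattice homomorphisms from the bounded continuous functions to the reals with norm
at most one, as plain functions. -/
def latticeChars (Ω : Type u) [TopologicalSpace Ω] : Set ((Ω →ᵇ ℝ) → ℝ) :=
  {φ | (∀ x y, φ (x + y) = φ x + φ y) ∧ (∀ (c : ℝ) x, φ (c • x) = c * φ x) ∧
    (∀ x, φ |x| = |φ x|) ∧ ∀ x, |φ x| ≤ ‖x‖}

/-- Tychonoff: the conditions are closed and pointwise, inside the product of the intervals [-‖x‖,
‖x‖]. -/
lemma isCompact_latticeChars : IsCompact (latticeChars Ω) := by
  refine (isCompact_univ_pi fun x : Ω →ᵇ ℝ => isCompact_Icc (a := -‖x‖) (b := ‖x‖)).of_isClosed_subset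
    ?_ fun φ hφ x _ => abs_le.1 (hφ.2.2.2 x)
  simp only [latticeChars, Set.ofPred_and, Set.ofPred_forall]
  refine IsClosed.inter ?_ (IsClosed.inter ?_ (IsClosed.inter ?_ ?_))
  · exact isClosed_iInter fun x => isClosed_iInter fun y => isClosed_eq (by fun_prop) (by fun_prop)
  · exact isClosed_iInter fun c => isClosed_iInter fun y => isClosed_eq (by fun_prop) (by fun_prop)
  · exact isClosed_iInter fun x => isClosed_eq (by fun_prop) (by fun_prop)
  · exact isClosed_iInter fun x => isClosed_le (by fun_prop) (by fun_prop)

lemma eval_mem_latticeChars (ω : Ω) : (fun x : Ω →ᵇ ℝ => x ω) ∈ latticeChars Ω :=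
  ⟨fun _ _ => rfl, fun _ _ => rfl, fun _ => rfl, fun x => x.norm_coe_le_norm ω⟩

variable {E : NSub (Ω →ᵇ ℝ)} (I : NSub E)

/-- The lattice characters that vanish on `I`. -/
def annChars : Set ((Ω →ᵇ ℝ) → ℝ) := {φ ∈ latticeChars Ω | ∀ z ∈ I, φ z = 0}

instance : CompactSpace (annChars I) := by
  refine isCompact_iff_compactSpace.1 (isCompact_latticeChars.of_isClosed_subset ?_ fun φ hφ => hφ.1)
  simp only [annChars, Set.ofPred_and, Set.ofPred_forall]
  refine isCompact_latticeChars.isClosed.inter ?_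
  exact isClosed_iInter fun x => isClosed_iInter fun _ => isClosed_eq (by fun_prop) (by fun_prop)

/-- Evaluation of the elements of `E` on the lattice characters that vanish on `I`. -/
def gelfandMap : E →ₗ[ℝ] C(annChars I, ℝ) where
  toFun x := ⟨fun φ => φ.1 x, (continuous_apply _).comp continuous_subtype_val⟩
  map_add' x y := by ext φ; exact φ.2.1.1 x y
  map_smul' c x := by ext φ; exact φ.2.1.2.1 c x

/-- The map induced by evaluation on the quotient. -/
def gelfandQuot : E ⧸ I →ₗ[ℝ] C(annChars I, ℝ) :=
  I.liftQ (gelfandMap I) fun z hz => by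
    ext φ
    exact φ.2.2 z hz

lemma gelfandQuot_mk (x : E) (φ : annChars I) :
    gelfandQuot I (Submodule.Quotient.mk x) φ = φ.1 x := rfl

variable {I}

lemma sup_mem_of_abs_mem (hE : ∀ x ∈ E, |x| ∈ E) {x y : Ω →ᵇ ℝ} (hx : x ∈ E) (hy : y ∈ E) :
    x ⊔ y ∈ E := by
  have : x ⊔ y = (2⁻¹ : ℝ) • (x + y + |x - y|) := by
    ext ω
    change max (x ω) (y ω) = 2⁻¹ * (x ω + y ω + |x ω - y ω|)
    rcases le_total (x ω) (y ω) with h | h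
    · rw [max_eq_right h, abs_of_nonpos (by linarith)]; ring
    · rw [max_eq_left h, abs_of_nonneg (by linarith)]; ring
  rw [this]
  exact E.smul_mem _ (add_mem (add_mem hx hy) (hE _ (sub_mem hx hy)))

lemma inf_mem_of_abs_mem (hE : ∀ x ∈ E, |x| ∈ E) {x y : Ω →ᵇ ℝ} (hx : x ∈ E) (hy : y ∈ E) :
    x ⊓ y ∈ E := by
  have : x ⊓ y = x + y - x ⊔ y := by
    ext ω
    change min (x ω) (y ω) = x ω + y ω - max (x ω) (y ω)
    rw [← min_add_max (x ω) (y ω)]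
    ring
  rw [this]
  exact sub_mem (add_mem hx hy) (sup_mem_of_abs_mem hE hx hy)

/-- This is the hard half of the isometry. Characters with |φ x| ≥ s form a compact set on which no
φ kills `I`, so finitely many elements of `I` are large there. Clamping x between -w and w, with w
the sum of their absolute values, gives the approximant y. -/
lemma exists_norm_sub_le (hE : ∀ x ∈ E, |x| ∈ E)
    (hI : ∀ y ∈ I, ∀ z : E, |(z : Ω →ᵇ ℝ)| ≤ |(y : Ω →ᵇ ℝ)| → z ∈ I) (x : E) {s : ℝ} (hs0 : 0 ≤ s)
    (hs : ∀ φ ∈ annChars I, |φ x| < s) : ∃ y ∈ I, ‖x - y‖ ≤ s := by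
  have hIabs : ∀ z : E, z ∈ I → (⟨|z.1|, hE _ z.2⟩ : E) ∈ I := fun z hz =>
    hI z hz _ (abs_abs _).le
  have hG : IsCompact (latticeChars Ω ∩ {φ | s ≤ |φ x|}) :=
    isCompact_latticeChars.inter_right (isClosed_le (by fun_prop) (by fun_prop))
  obtain ⟨t, ht⟩ := hG.elim_finite_subcover (fun z : I => {φ : (Ω →ᵇ ℝ) → ℝ | ‖x‖ < |φ z.1|})
    (fun z => isOpen_lt (by fun_prop) (by fun_prop)) (by
      rintro φ ⟨hφ, hφx⟩
      have : ∃ z ∈ I, φ z ≠ 0 := by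
        by_contra! h
        exact (hs φ ⟨hφ, h⟩).not_ge hφx
      obtain ⟨z, hz, hz0⟩ := this
      refine Set.mem_iUnion.2 ⟨⟨((‖x‖ + 1) / |φ z|) • z, I.smul_mem _ hz⟩, ?_⟩
      have h0 : 0 < |φ z| := abs_pos.2 hz0
      change ‖x‖ < |φ (((‖x‖ + 1) / |φ z|) • z.1)|
      rw [hφ.2.1, abs_mul, abs_of_nonneg (by positivity), div_mul_cancel₀ _ h0.ne']
      linarith)
  let w : E := ∑ z ∈ t, ⟨|z.1.1|, hE _ z.1.2⟩
  have hw : w ∈ I := sum_mem fun z _ => hIabs _ z.2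
  have hwω : ∀ ω, w.1 ω = ∑ z ∈ t, |z.1.1 ω| := by
    intro ω
    simp only [w, AddSubmonoidClass.coe_finsetSum, BoundedContinuousFunction.coe_sum,
      Finset.sum_apply]
    rfl
  have hw0 : ∀ ω, 0 ≤ w.1 ω := fun ω => by
    rw [hwω]
    exact Finset.sum_nonneg fun _ _ => abs_nonneg _
  let y : E := ⟨(x.1 ⊓ w.1) ⊔ (-w.1),
    sup_mem_of_abs_mem hE (inf_mem_of_abs_mem hE x.2 w.2) (neg_mem w.2)⟩
  have hyω : ∀ ω, y.1 ω = max (min (x.1 ω) (w.1 ω)) (-w.1 ω) := fun _ => rfl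
  refine ⟨y, hI w hw y fun ω => ?_, ?_⟩
  · change |y.1 ω| ≤ |w.1 ω|
    rw [hyω, abs_of_nonneg (hw0 ω), abs_le]
    exact ⟨le_max_right _ _, max_le (min_le_right _ _) (by linarith [hw0 ω])⟩
  · refine (BoundedContinuousFunction.norm_le hs0).2 fun ω => ?_
    change |x.1 ω - y.1 ω| ≤ s
    rw [hyω]
    -- Where |x ω| ≥ s, evaluation at ω lies in the covered set, so w ω ≥ |x ω| and clamping changes
    -- nothing. Elsewhere clamping moves x ω by at most |x ω| < s.
    rcases le_or_gt s |x.1 ω| with h | h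
    · obtain ⟨z, hz⟩ := Set.mem_iUnion.1 (ht ⟨eval_mem_latticeChars ω, h⟩)
      obtain ⟨hzt, hz⟩ := Set.mem_iUnion.1 hz
      have h1 : |x.1 ω| ≤ w.1 ω := by
        rw [hwω]
        refine (x.1.norm_coe_le_norm ω).trans (le_trans (le_of_lt hz) ?_)
        exact Finset.single_le_sum (f := fun z : I => |z.1.1 ω|) (fun _ _ => abs_nonneg _) hzt
      rw [abs_le] at h1
      rw [min_eq_left h1.2, max_eq_left h1.1]
      simpa using hs0
    · refine le_trans ?_ h.le
      have := hw0 ω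
      rcases le_total (x.1 ω) (w.1 ω) with h1 | h1
      · rw [min_eq_left h1]
        rcases le_total (-w.1 ω) (x.1 ω) with h2 | h2
        · rw [max_eq_left h2]; simp
        · rw [max_eq_right h2, abs_of_nonpos (by linarith), abs_of_nonpos (by linarith)]
          linarith
      · rw [min_eq_right h1, max_eq_left (by linarith), abs_of_nonneg (by linarith),
          abs_of_nonneg (by linarith)]
        linarith

/-- Characters are contractive and do not see the representative, giving ≤; `exists_norm_sub_le`
with s slightly above the sup norm gives ≥. -/
lemma norm_gelfandQuot (hE : ∀ x ∈ E, |x| ∈ E)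
    (hI : ∀ y ∈ I, ∀ z : E, |(z : Ω →ᵇ ℝ)| ≤ |(y : Ω →ᵇ ℝ)| → z ∈ I) (q : E ⧸ I) :
    ‖gelfandQuot I q‖ = ‖q‖ := by
  obtain ⟨x, rfl⟩ := Submodule.Quotient.mk_surjective I q
  refine le_antisymm ?_ (le_of_forall_pos_le_add fun ε hε => ?_)
  · refine (ContinuousMap.norm_le _ (norm_nonneg _)).2 fun φ => ?_
    rw [gelfandQuot_mk]
    refine le_of_forall_pos_le_add fun ε hε => ?_
    obtain ⟨m, hm, hlt⟩ := Submodule.Quotient.norm_mk_lt (Submodule.Quotient.mk (p := I) x) hε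
    have h : φ.1 x = φ.1 m := by
      rw [← gelfandQuot_mk I x φ, ← gelfandQuot_mk I m φ, hm]
    rw [h]
    exact (φ.2.1.2.2.2 m).trans hlt.le
  · obtain ⟨y, hy, hxy⟩ := exists_norm_sub_le hE hI x
      (s := ‖gelfandQuot I (Submodule.Quotient.mk x)‖ + ε) (by positivity) fun φ hφ => by
        have := (gelfandQuot I (Submodule.Quotient.mk x)).norm_coe_le_norm ⟨φ, hφ⟩
        rw [gelfandQuot_mk, Real.norm_eq_abs] at this
        linarith
    have h : (Submodule.Quotient.mk x : E ⧸ I) = Submodule.Quotient.mk (x - y) := by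
      rw [Submodule.Quotient.eq]
      simpa using hy
    rw [h]
    exact (Submodule.Quotient.norm_mk_le I (x - y)).trans (h ▸ hxy)

/-- The quotient of a sublattice of the bounded continuous functions by an ideal, represented as a
space of continuous functions. -/
def gelfandIsometry (hE : ∀ x ∈ E, |x| ∈ E)
    (hI : ∀ y ∈ I, ∀ z : E, |(z : Ω →ᵇ ℝ)| ≤ |(y : Ω →ᵇ ℝ)| → z ∈ I) :
    E ⧸ I →ₗᵢ[ℝ] C(annChars I, ℝ) :=
  ⟨gelfandQuot I, norm_gelfandQuot hE hI⟩

lemma gelfandQuot_mk_abs (hE : ∀ x ∈ E, |x| ∈ E) (x : E) :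
    gelfandQuot I (Submodule.Quotient.mk ⟨|x.1|, hE _ x.2⟩)
      = |gelfandQuot I (Submodule.Quotient.mk x)| := by
  ext φ
  exact φ.2.1.2.2.1 x

end Representation

/-! ### Fundamental semigroups dominate the ideal generated by compact sets -/

section Fundamental

variable {X : Type u} [NormedAddCommGroup X] [NormedSpace ℝ X]

lemma isClosedIdeal_idealK : IsClosedIdeal X (idealK X) where
  closed := by
    rw [idealK, Submodule.coe_sInf]
    exact isClosed_biInter fun I hI => hI.1.closed
  solid y hy z hz := by
    rw [idealK, Submodule.mem_sInf] at hy ⊢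
    exact fun I hI => hI.1.solid y (hy I hI) z hz

lemma mem_idealK_of_mem_spaceK {z : spaceC X} (hz : (z : DualBall X →ᵇ ℝ) ∈ spaceK X) :
    z ∈ idealK X := by
  rw [idealK, Submodule.mem_sInf]
  exact fun I hI => hI.2 z hz

variable {𝒟 : Set (Set X)}

lemma IsFundamental.mem_BddSets (h𝒟 : IsFundamental 𝒟) {D : Set X} (hD : D ∈ 𝒟) :
    D ∈ BddSets X :=
  mem_BddSets_of_mem_CvxSets (h𝒟.subset hD)

lemma IsFundamental.exists_finite_subset (h𝒟 : IsFundamental 𝒟) {s : Set X} (hs : s.Finite) :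
    ∃ D ∈ 𝒟, s ⊆ D := by
  have h1 : ∀ x : X, ∃ D ∈ 𝒟, x ∈ D := fun x => by
    have := h𝒟.sUnion_eq ▸ Set.mem_univ x
    exact this
  induction s, hs using Set.Finite.induction_on with
  | empty =>
    obtain ⟨D, hD, -⟩ := h1 0
    exact ⟨D, hD, Set.empty_subset D⟩
  | @insert a s _ _ ih =>
    obtain ⟨D, hD, hs⟩ := ih
    obtain ⟨C, hC, ha⟩ := h1 a
    refine ⟨_, h𝒟.hull_mem C hC D hD, Set.insert_subset ?_ fun x hx => ?_⟩
    · exact subset_clco _ (Or.inl (Or.inl ha))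
    · exact subset_clco _ (Or.inr (Or.inl (hs hx)))

/-- Hulls of finite nets belong to `𝒟` and approximate K in the Hausdorff metric. -/
lemma IsFundamental.mem_of_mem_CptSets (h𝒟 : IsFundamental 𝒟) {K : Set X} (hK : K ∈ CptSets X) :
    K ∈ 𝒟 := by
  refine h𝒟.closed K (mem_CvxSets_of_mem_CptSets hK) fun ε hε => ?_
  obtain ⟨t, htK, htf, ht⟩ := hK.2.1.finite_cover_balls (half_pos hε)
  have htne : t.Nonempty := by
    obtain ⟨x, hx⟩ := hK.1
    obtain ⟨y, hy, -⟩ := Set.mem_iUnion₂.1 (ht hx)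
    exact ⟨y, hy⟩
  obtain ⟨D, hD, htD⟩ := h𝒟.exists_finite_subset htf
  refine ⟨clco t, h𝒟.sub_mem D hD t htne htD, ?_⟩
  refine (Metric.hausdorffDist_le_of_mem_dist (half_pos hε).le (fun x hx => ?_)
    fun x hx => ?_).trans_lt (half_lt_self hε)
  · obtain ⟨y, hy, hxy⟩ := Set.mem_iUnion₂.1 (ht hx)
    exact ⟨y, subset_clco t hy, (Metric.mem_ball.1 hxy).le⟩
  · exact ⟨x, clco_subset (mem_CvxSets_of_mem_CptSets hK) htK hx,
      (dist_self x).le.trans (half_pos hε).le⟩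

/-- Integer multiples come from repeated addition; a real k is reached by shrinking towards 0 inside
a convex member of `𝒟`. -/
lemma IsFundamental.exists_smul_subset (h𝒟 : IsFundamental 𝒟) {D : Set X} (hD : D ∈ 𝒟) {k : ℝ}
    (hk : 0 ≤ k) : ∃ C ∈ 𝒟, k • D ⊆ C := by
  have hnat : ∀ n : ℕ, ∃ C ∈ 𝒟, ∀ x ∈ D, ((n : ℝ) • x) ∈ C := by
    intro n
    induction n with
    | zero =>
      obtain ⟨C, hC, h0⟩ := h𝒟.exists_finite_subset (Set.finite_singleton (0 : X))
      exact ⟨C, hC, fun x _ => by simpa using h0⟩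
    | succ n ih =>
      obtain ⟨C, hC, h⟩ := ih
      refine ⟨_, h𝒟.add_mem C hC D hD, fun x hx => subset_closure ?_⟩
      push_cast
      rw [add_smul, one_smul]
      exact Set.add_mem_add (h x hx) hx
  obtain ⟨n, hn⟩ := exists_nat_gt k
  obtain ⟨C, hC, h⟩ := hnat n
  -- Z only serves to put 0 in the hull, which then contains the segment from 0 to n • x.
  obtain ⟨Z, hZ, h0⟩ := h𝒟.exists_finite_subset (Set.finite_singleton (0 : X))
  have hn0 : (0 : ℝ) < n := hk.trans_lt hn
  refine ⟨_, h𝒟.hull_mem C hC Z hZ, ?_⟩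
  rintro _ ⟨x, hx, rfl⟩
  have hv : Convex ℝ (clco ((C ∪ -C) ∪ (Z ∪ -Z))) := (convex_convexHull ℝ _).closure
  have := hv.smul_mem_of_zero_mem (x := (n : ℝ) • x) (subset_clco _ (Or.inr (Or.inl (h0 rfl))))
    (subset_clco _ (Or.inl (Or.inl (h x hx)))) (t := k / n)
    ⟨by positivity, (div_le_one hn0).2 hn.le⟩
  rwa [smul_smul, div_mul_cancel₀ _ hn0.ne'] at this

/-- The bounded continuous functions that are dominated, up to arbitrarily small constants, by
support functions of members of `𝒟`. -/
def IsFundamental.dominated (h𝒟 : IsFundamental 𝒟) : NSub (DualBall X →ᵇ ℝ) where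
  carrier := {z | ∀ ε > 0, ∃ D ∈ 𝒟, ∀ ω, |z ω| ≤ J D ω + ε}
  zero_mem' ε hε := by
    obtain ⟨Z, hZ, h0⟩ := h𝒟.exists_finite_subset (Set.finite_singleton (0 : X))
    refine ⟨Z, hZ, fun ω => ?_⟩
    have := le_J (h𝒟.mem_BddSets hZ) ω (h0 rfl)
    rw [map_zero] at this
    simp only [BoundedContinuousFunction.coe_zero, Pi.zero_apply, abs_zero]
    positivity
  add_mem' {y z} hy hz ε hε := by
    obtain ⟨C, hC, h1⟩ := hy (ε / 2) (half_pos hε)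
    obtain ⟨D, hD, h2⟩ := hz (ε / 2) (half_pos hε)
    refine ⟨_, h𝒟.add_mem C hC D hD, fun ω => ?_⟩
    have hCD := add_mem_BddSets (h𝒟.mem_BddSets hC) (h𝒟.mem_BddSets hD)
    have h3 : J (C + D) ω ≤ J (closure (C + D)) ω :=
      J_mono hCD (h𝒟.mem_BddSets (h𝒟.add_mem C hC D hD)) subset_closure ω
    rw [J_add (h𝒟.mem_BddSets hC) (h𝒟.mem_BddSets hD)] at h3
    have h4 : J C ω + J D ω ≤ J (closure (C + D)) ω := h3
    have := abs_add_le (y ω) (z ω)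
    change |y ω + z ω| ≤ _
    linarith [h1 ω, h2 ω]
  smul_mem' c z hz ε hε := by
    obtain ⟨D, hD, h⟩ := hz (ε / (|c| + 1)) (by positivity)
    obtain ⟨C, hC, hDC⟩ := h𝒟.exists_smul_subset hD (abs_nonneg c)
    refine ⟨C, hC, fun ω => ?_⟩
    have h1 := J_mono (smul_mem_BddSets (h𝒟.mem_BddSets hD) |c|) (h𝒟.mem_BddSets hC) hDC ω
    rw [J_smul (h𝒟.mem_BddSets hD) (abs_nonneg c)] at h1
    have h2 : |c| * J D ω ≤ J C ω := h1
    have h3 : |c| * (ε / (|c| + 1)) ≤ ε := by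
      rw [mul_div_assoc', div_le_iff₀ (by positivity)]
      nlinarith [abs_nonneg c]
    change |c * z ω| ≤ _
    rw [abs_mul]
    have := mul_le_mul_of_nonneg_left (h ω) (abs_nonneg c)
    rw [mul_add] at this
    linarith

lemma IsFundamental.isClosed_dominated (h𝒟 : IsFundamental 𝒟) :
    IsClosed (h𝒟.dominated : Set (DualBall X →ᵇ ℝ)) := by
  refine isClosed_of_closure_subset fun z hz ε hε => ?_
  obtain ⟨y, hy, hzy⟩ := Metric.mem_closure_iff.1 hz (ε / 2) (half_pos hε)
  obtain ⟨D, hD, h⟩ := hy (ε / 2) (half_pos hε)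
  refine ⟨D, hD, fun ω => ?_⟩
  have h1 := (BoundedContinuousFunction.dist_coe_le_dist (f := z) (g := y) ω).trans hzy.le
  rw [Real.dist_eq] at h1
  have := abs_sub_abs_le_abs_sub (z ω) (y ω)
  linarith [h ω]

lemma IsFundamental.spaceK_le_dominated (h𝒟 : IsFundamental 𝒟) : spaceK X ≤ h𝒟.dominated := by
  refine Submodule.topologicalClosure_minimal _ (Submodule.span_le.2 ?_) h𝒟.isClosed_dominated
  rintro _ ⟨K, hK, rfl⟩ ε hε
  have hK𝒟 := h𝒟.mem_of_mem_CptSets hK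
  have hKb := h𝒟.mem_BddSets hK𝒟
  -- J K may be negative, so the dominating set must be symmetrized.
  have hL := h𝒟.hull_mem K hK𝒟 K hK𝒟
  refine ⟨_, hL, fun ω => ?_⟩
  refine le_trans (abs_le'.2 ⟨?_, ?_⟩) (le_add_of_nonneg_right hε.le)
  · exact J_mono hKb (h𝒟.mem_BddSets hL) (fun x hx => subset_clco _ (Or.inl (Or.inl hx))) ω
  · obtain ⟨x, hx⟩ := hKb.1
    have h1 := le_J hKb ω hx
    have h2 := le_J (h𝒟.mem_BddSets hL) ω (a := -x)
      (subset_clco _ (Or.inl (Or.inr (Set.neg_mem_neg.2 hx))))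
    rw [map_neg] at h2
    linarith

/-- Domination defines a closed ideal containing `spaceK X`; minimality of `idealK X` does the rest.
-/
lemma IsFundamental.exists_abs_le_of_mem_idealK (h𝒟 : IsFundamental 𝒟) {z : spaceC X}
    (hz : z ∈ idealK X) {ε : ℝ} (hε : 0 < ε) : ∃ D ∈ 𝒟, ∀ ω, |z.1 ω| ≤ J D ω + ε := by
  rw [idealK, Submodule.mem_sInf] at hz
  refine hz (h𝒟.dominated.comap (spaceC X).subtype)
    ⟨⟨h𝒟.isClosed_dominated.preimage continuous_subtype_val, fun y hy w hw ε hε => ?_⟩,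
      fun w hw => h𝒟.spaceK_le_dominated hw⟩ ε hε
  obtain ⟨D, hD, h⟩ := hy ε hε
  exact ⟨D, hD, fun ω => (hw ω).trans (h ω)⟩

end Fundamental

/-! ### From inequalities of support functions to inclusions -/

section Inclusion

variable {X : Type u} [NormedAddCommGroup X] [NormedSpace ℝ X]

/-- Support functions on the dual unit ball determine inclusions up to closure, an additive
constant corresponding to a ball. -/
lemma subset_of_J_le {A C : Set X} (hA : A ∈ BddSets X) (hC : C ∈ BddSets X) (hCv : Convex ℝ C)
    {d d' : ℝ} (hd : 0 ≤ d) (hdd : d < d') (h : ∀ ω, J A ω ≤ J C ω + d) :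
    A ⊆ C + d' • unitBall X := by
  have hSb : C + d • unitBall X ∈ BddSets X :=
    add_mem_BddSets hC (smul_mem_BddSets unitBall_mem_BddSets d)
  have hSv : Convex ℝ (C + d • unitBall X) := hCv.add ((convex_closedBall 0 1).smul d)
  intro a ha
  have hcl : a ∈ closure (C + d • unitBall X) := by
    by_contra hna
    obtain ⟨f, v, hfv, hva⟩ := geometric_hahn_banach_closed_point hSv.closure isClosed_closure hna
    have hf : 0 < ‖f‖ := by
      rw [norm_pos_iff]
      rintro rfl
      obtain ⟨s, hs⟩ := hSb.1
      simpa using (hfv s (subset_closure hs)).trans hva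
    -- The separating functional is normalized so that the support function of the unit ball is at
    -- least 1 at ω, which absorbs the constant d.
    let ω : DualBall X := ⟨‖f‖⁻¹ • f, by
      rw [mem_closedBall_zero_iff, norm_smul, norm_inv, norm_norm, inv_mul_cancel₀ hf.ne']⟩
    have hω : ∀ x, ω.1 x = ‖f‖⁻¹ * f x := fun _ => rfl
    have hωn : ‖ω.1‖ = 1 := by
      change ‖‖f‖⁻¹ • f‖ = 1
      rw [norm_smul, norm_inv, norm_norm, inv_mul_cancel₀ hf.ne']
    have h1 : J (C + d • unitBall X) ω ≤ ‖f‖⁻¹ * v := J_le hSb fun s hs => by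
      rw [hω]
      exact mul_le_mul_of_nonneg_left (hfv s (subset_closure hs)).le (by positivity)
    rw [J_add hC (smul_mem_BddSets unitBall_mem_BddSets d), J_smul unitBall_mem_BddSets hd] at h1
    have h2 : J C ω + d * J (unitBall X) ω ≤ ‖f‖⁻¹ * v := h1
    have h3 := norm_le_J_unitBall ω
    rw [hωn] at h3
    have h4 := le_J hA ω ha
    rw [hω] at h4
    have h5 : ‖f‖⁻¹ * v < ‖f‖⁻¹ * f a := mul_lt_mul_of_pos_left hva (by positivity)
    nlinarith [h ω]
  -- The gap d' - d pays for removing the closure.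
  obtain ⟨s, ⟨c, hc, x, hx, rfl⟩, hs⟩ := Metric.mem_closure_iff.1 hcl (d' - d) (sub_pos.2 hdd)
  refine ⟨c, hc, a - c, ?_, by simp⟩
  rw [mem_smul_unitBall hd] at hx
  rw [mem_smul_unitBall (hd.trans hdd.le)]
  rw [dist_eq_norm] at hs
  have : a - c = (a - (c + x)) + x := by abel
  rw [this]
  refine (norm_add_le _ _).trans ?_
  linarith

end Inclusion

/-- Convexity yields errors linear in a small parameter t; this lets t tend to 0. -/
lemma le_of_forall_le_add_mul {a b c : ℝ} (h : ∀ t : ℝ, 0 < t → t ≤ 1 → a ≤ b + t * c) :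
    a ≤ b := by
  have hlim : Filter.Tendsto (fun t : ℝ => b + t * c) (nhdsWithin 0 (Set.Ioi 0)) (nhds b) := by
    have : Filter.Tendsto (fun t : ℝ => b + t * c) (nhds 0) (nhds (b + 0 * c)) :=
      Continuous.tendsto (by fun_prop) 0
    rw [zero_mul, add_zero] at this
    exact this.mono_left nhdsWithin_le_nhds
  refine ge_of_tendsto hlim ?_
  filter_upwards [Ioc_mem_nhdsGT (zero_lt_one' ℝ)] with t ht using h t ht.1 ht.2

/-! ### Classes of support functions modulo the ideal -/

section Quotient

variable {X : Type u} [NormedAddCommGroup X] [NormedSpace ℝ X]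

lemma QJ_eq {A : Set X} (hA : A ∈ BddSets X) :
    QJ A = Submodule.Quotient.mk ⟨J A, J_mem_spaceC hA⟩ := by
  simp only [QJ, J_clco hA]

lemma QJ_add {A B : Set X} (hA : A ∈ BddSets X) (hB : B ∈ BddSets X) :
    QJ (A + B) = QJ A + QJ B := by
  rw [QJ_eq hA, QJ_eq hB, QJ_eq (add_mem_BddSets hA hB), ← Submodule.Quotient.mk_add]
  simp only [J_add hA hB]
  rfl

lemma QJ_smul {A : Set X} (hA : A ∈ BddSets X) {k : ℝ} (hk : 0 ≤ k) :
    QJ (k • A) = k • QJ A := by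
  rw [QJ_eq hA, QJ_eq (smul_mem_BddSets hA k), ← Submodule.Quotient.mk_smul]
  simp only [J_smul hA hk]
  rfl

lemma QJ_singleton (x : X) : QJ ({x} : Set X) = 0 := by
  have hc : ({x} : Set X) ∈ CptSets X :=
    ⟨Set.singleton_nonempty x, isCompact_singleton, convex_singleton x⟩
  rw [QJ_eq (singleton_mem_BddSets x), Submodule.Quotient.mk_eq_zero]
  exact mem_idealK_of_mem_spaceK
    (Submodule.le_topologicalClosure _ (Submodule.subset_span ⟨_, hc, rfl⟩))

lemma norm_QJ_unitBall_le : ‖QJ (unitBall X)‖ ≤ 1 := by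
  rw [QJ_eq unitBall_mem_BddSets]
  refine (Submodule.Quotient.norm_mk_le _ _).trans ?_
  refine (BoundedContinuousFunction.norm_le zero_le_one).2 fun ω => ?_
  have hω : ‖ω.1‖ ≤ 1 := mem_closedBall_zero_iff.1 ω.2
  refine (Real.norm_eq_abs _).trans_le (abs_le.2 ⟨?_, J_le unitBall_mem_BddSets fun x hx => ?_⟩)
  · exact (neg_nonpos.2 zero_le_one).trans ((norm_nonneg _).trans (norm_le_J_unitBall ω))
  · exact (le_abs_self _).trans ((ω.1.le_opNorm x).trans
      (mul_le_one₀ hω (norm_nonneg _) (mem_closedBall_zero_iff.1 hx)))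

/-- Here z is J A - J B minus a representative of its class of norm below d. -/
lemma exists_J_le_of_norm_lt {A B : Set X} (hA : A ∈ BddSets X) (hB : B ∈ BddSets X) {d : ℝ}
    (h : ‖QJ A - QJ B‖ < d) :
    ∃ z ∈ idealK X, ∀ ω, J A ω ≤ J B ω + z.1 ω + d := by
  obtain ⟨m, hm, hlt⟩ := Submodule.Quotient.norm_mk_lt (QJ A - QJ B) (sub_pos.2 h)
  rw [add_sub_cancel] at hlt
  refine ⟨⟨J A, J_mem_spaceC hA⟩ - ⟨J B, J_mem_spaceC hB⟩ - m, ?_, fun ω => ?_⟩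
  · rw [← Submodule.Quotient.mk_eq_zero, Submodule.Quotient.mk_sub, Submodule.Quotient.mk_sub,
      hm, QJ_eq hA, QJ_eq hB, sub_self]
  · change J A ω ≤ J B ω + (J A ω - J B ω - m.1 ω) + d
    have := (le_abs_self _).trans ((m.1.norm_coe_le_norm ω).trans hlt.le)
    linarith

lemma exists_J_le_of_nonneg {A B : Set X} (hA : A ∈ BddSets X) (hB : B ∈ BddSets X)
    (h : ∃ x : spaceC X, 0 ≤ (x : DualBall X →ᵇ ℝ) ∧ Submodule.Quotient.mk x = QJ B - QJ A) :
    ∃ z ∈ idealK X, ∀ ω, J A ω ≤ J B ω + z.1 ω + 0 := by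
  obtain ⟨x, hx0, hx⟩ := h
  refine ⟨x - (⟨J B, J_mem_spaceC hB⟩ - ⟨J A, J_mem_spaceC hA⟩), ?_, fun ω => ?_⟩
  · rw [← Submodule.Quotient.mk_eq_zero, Submodule.Quotient.mk_sub, Submodule.Quotient.mk_sub,
      hx, QJ_eq hA, QJ_eq hB, sub_self]
  · change J A ω ≤ J B ω + (x.1 ω - (J B ω - J A ω)) + 0
    have : 0 ≤ x.1 ω := hx0 ω
    linarith

end Quotient

/-! ### Estimates for convex and sublinear measures -/

section Measures

variable {X : Type u} [NormedAddCommGroup X] [NormedSpace ℝ X] {𝒟 : Set (Set X)} {μ : Set X → ℝ}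

lemma IsMNP.eq_zero_of_subset (h𝒟 : IsFundamental 𝒟) (hμ : IsMNP 𝒟 μ) {B D : Set X} (hD : D ∈ 𝒟)
    (hB : B.Nonempty) (h : B ⊆ D) : μ B = 0 :=
  (hμ.eq_zero_iff B (mem_BddSets_of_subset (h𝒟.mem_BddSets hD) hB h)).2 (h𝒟.sub_mem D hD B hB h)

namespace IsConvexMNP

/-- Since s + t = t(s + 1) + (1 - t)s, convexity applies; it gives right continuity of μ under
dilation. -/
lemma add_smul_le (hμ : IsConvexMNP 𝒟 μ) {C : Set X} (hC : C ∈ BddSets X) (s : ℝ) {t : ℝ}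
    (ht : 0 < t) (ht1 : t ≤ 1) :
    μ ((s + t) • C) ≤ μ (s • C) + t * μ ((s + 1) • C) := by
  have h1 := smul_mem_BddSets hC s
  have h2 := smul_mem_BddSets hC (s + 1)
  have hsub : (s + t) • C ⊆ t • ((s + 1) • C) + (1 - t) • (s • C) := by
    rintro _ ⟨x, hx, rfl⟩
    refine ⟨t • (s + 1) • x, Set.smul_mem_smul_set (Set.smul_mem_smul_set hx),
      (1 - t) • s • x, Set.smul_mem_smul_set (Set.smul_mem_smul_set hx), ?_⟩
    simp only
    module
  have h3 := hμ.mono _ (add_mem_BddSets (smul_mem_BddSets h2 t) (smul_mem_BddSets h1 (1 - t))) _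
    (smul_mem_BddSets hC _) hsub
  have h4 := hμ.convex _ h2 _ h1 t ht.le ht1
  nlinarith [hμ.nonneg _ h1]

/-- C + D lies in a convex combination of (1 + t)C and a large dilate of D. That dilate has measure
0, being inside a member of `𝒟`; then t → 0. -/
lemma add_le_of_mem (h𝒟 : IsFundamental 𝒟) (hμ : IsConvexMNP 𝒟 μ) {C D : Set X}
    (hC : C ∈ BddSets X) (hD : D ∈ 𝒟) : μ (C + D) ≤ μ C := by
  refine le_of_forall_le_add_mul (c := μ ((1 + 1 : ℝ) • C)) fun t ht ht1 => ?_
  have hDb := h𝒟.mem_BddSets hD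
  let s := (1 + t)⁻¹
  have hs : 0 < s := by positivity
  have hst : s * (1 + t) = 1 := inv_mul_cancel₀ (by positivity)
  have hs1 : s < 1 := inv_lt_one_of_one_lt₀ (by linarith)
  have h1 := smul_mem_BddSets hC (1 + t)
  have h2 := smul_mem_BddSets hDb (1 - s)⁻¹
  have hsub : C + D ⊆ s • ((1 + t) • C) + (1 - s) • ((1 - s)⁻¹ • D) := by
    rw [smul_smul, smul_smul, hst, mul_inv_cancel₀ (sub_pos.2 hs1).ne', one_smul, one_smul]
  obtain ⟨Z, hZ, hDZ⟩ := h𝒟.exists_smul_subset hD (inv_nonneg.2 (sub_pos.2 hs1).le)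
  have h0 : μ ((1 - s)⁻¹ • D) = 0 := hμ.eq_zero_of_subset h𝒟 hZ h2.1 hDZ
  have h3 := hμ.mono _ (add_mem_BddSets (smul_mem_BddSets h1 s) (smul_mem_BddSets h2 (1 - s))) _
    (add_mem_BddSets hC hDb) hsub
  have h4 := hμ.convex _ h1 _ h2 s hs.le hs1.le
  have h5 := hμ.add_smul_le hC 1 ht ht1
  rw [one_smul] at h5
  rw [h0] at h4
  nlinarith [hμ.nonneg _ h1]

/-- The hull of B appears because separation needs a convex set. Half of d' - d is spent on
dominating z, the rest on the closure. -/
lemma le_of_J_le (h𝒟 : IsFundamental 𝒟) (hμ : IsConvexMNP 𝒟 μ) {A B : Set X}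
    (hA : A ∈ BddSets X) (hB : B ∈ BddSets X) {d d' : ℝ} (hd : 0 ≤ d) (hdd : d < d')
    (h : ∃ z ∈ idealK X, ∀ ω, J A ω ≤ J B ω + z.1 ω + d) :
    μ A ≤ μ (convexHull ℝ B + d' • unitBall X) := by
  obtain ⟨z, hz, hle⟩ := h
  obtain ⟨D, hD, hzD⟩ := h𝒟.exists_abs_le_of_mem_idealK hz (half_pos (sub_pos.2 hdd))
  have hBc := convexHull_mem_BddSets hB
  have hDb := h𝒟.mem_BddSets hD
  have hsub : A ⊆ convexHull ℝ B + D + d' • unitBall X := by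
    refine subset_of_J_le hA (add_mem_BddSets hBc hDb)
      ((convex_convexHull ℝ B).add (h𝒟.subset hD).2.2.2) (d := d + (d' - d) / 2)
      (by linarith) (by linarith) fun ω => ?_
    rw [J_add hBc hDb]
    change J A ω ≤ J (convexHull ℝ B) ω + J D ω + _
    have := J_mono hB hBc (subset_convexHull ℝ B) ω
    linarith [hle ω, (le_abs_self _).trans (hzD ω)]
  have hBd := add_mem_BddSets hBc (smul_mem_BddSets unitBall_mem_BddSets d')
  rw [add_right_comm] at hsub
  exact (hμ.mono _ (add_mem_BddSets hBd hDb) _ hA hsub).trans (hμ.add_le_of_mem h𝒟 hBd hD)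

lemma add_smul_unitBall_le (hμ : IsConvexMNP 𝒟 μ) {B : Set X} (hB : B ∈ BddSets X) {t : ℝ}
    (ht : 0 ≤ t) (ht1 : t ≤ 1) :
    μ (convexHull ℝ B + t • unitBall X) ≤
      μ B + t * (μ (convexHull ℝ B + unitBall X) - μ B) := by
  have hBc := convexHull_mem_BddSets hB
  have hBu := add_mem_BddSets hBc unitBall_mem_BddSets
  have hsub : convexHull ℝ B + t • unitBall X ⊆
      t • (convexHull ℝ B + unitBall X) + (1 - t) • convexHull ℝ B := by
    rintro _ ⟨b, hb, _, ⟨x, hx, rfl⟩, rfl⟩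
    refine ⟨t • (b + x), Set.smul_mem_smul_set (Set.add_mem_add hb hx), (1 - t) • b,
      Set.smul_mem_smul_set hb, ?_⟩
    simp only
    module
  have h1 := hμ.mono _ (add_mem_BddSets (smul_mem_BddSets hBu t) (smul_mem_BddSets hBc (1 - t))) _
    (add_mem_BddSets hBc (smul_mem_BddSets unitBall_mem_BddSets t)) hsub
  have h2 := hμ.convex _ hBu _ hBc t ht ht1
  rw [hμ.convexHull_eq B hB] at h2
  linarith

lemma le_of_nonneg (h𝒟 : IsFundamental 𝒟) (hμ : IsConvexMNP 𝒟 μ) {A B : Set X}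
    (hA : A ∈ BddSets X) (hB : B ∈ BddSets X)
    (h : ∃ x : spaceC X, 0 ≤ (x : DualBall X →ᵇ ℝ) ∧ Submodule.Quotient.mk x = QJ B - QJ A) :
    μ A ≤ μ B :=
  le_of_forall_le_add_mul fun _ ht ht1 =>
    (hμ.le_of_J_le h𝒟 hA hB le_rfl ht (exists_J_le_of_nonneg hA hB h)).trans
      (hμ.add_smul_unitBall_le hB ht.le ht1)

lemma le_smul_unitBall (h𝒟 : IsFundamental 𝒟) (hμ : IsConvexMNP 𝒟 μ) {A : Set X}
    (hA : A ∈ BddSets X) {r : ℝ} (hr : ‖QJ A‖ ≤ r) : μ A ≤ μ (r • unitBall X) := by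
  refine le_of_forall_le_add_mul (c := μ ((r + 1) • unitBall X)) fun t ht ht1 => ?_
  have hr0 := (norm_nonneg _).trans hr
  have h := hμ.le_of_J_le h𝒟 hA (singleton_mem_BddSets 0) (d := r + t / 2) (d' := r + t)
    (by positivity) (by linarith) (exists_J_le_of_norm_lt hA (singleton_mem_BddSets 0) (by
      rw [QJ_singleton, sub_zero]
      linarith))
  rw [convexHull_singleton, Set.singleton_zero, zero_add] at h
  exact h.trans (hμ.add_smul_le unitBall_mem_BddSets r ht ht1)

lemma sub_le_mul_norm (h𝒟 : IsFundamental 𝒟) (hμ : IsConvexMNP 𝒟 μ) {A B : Set X}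
    (hA : A ∈ BddSets X) (hB : B ∈ BddSets X) {r : ℝ} (hAr : ‖QJ A‖ ≤ r) (hBr : ‖QJ B‖ ≤ r) :
    μ A - μ B ≤ μ ((1 + r) • unitBall X) * ‖QJ A - QJ B‖ := by
  have hc := hμ.nonneg _ (smul_mem_BddSets unitBall_mem_BddSets (1 + r))
  have hB0 := hμ.nonneg B hB
  -- At distance at least 1, the ball bound on μ A and μ B ≥ 0 suffice. Below 1, the distance is the
  -- parameter on the segment from co B to co B + ball, whose far end has norm at most 1 + r in the
  -- quotient.
  rcases le_or_gt 1 ‖QJ A - QJ B‖ with h1 | h1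
  · have := hμ.le_smul_unitBall h𝒟 hA (hAr.trans (by linarith : r ≤ 1 + r))
    nlinarith
  · have hBu : μ (convexHull ℝ B + unitBall X) ≤ μ ((1 + r) • unitBall X) := by
      have hsum := add_mem_BddSets hB (unitBall_mem_BddSets (X := X))
      have hcv : convexHull ℝ B + unitBall X = convexHull ℝ (B + unitBall X) := by
        rw [convexHull_add, (convex_closedBall (0 : X) 1).convexHull_eq]
      rw [hcv, hμ.convexHull_eq _ hsum]
      refine hμ.le_smul_unitBall h𝒟 hsum ?_
      rw [QJ_add hB unitBall_mem_BddSets]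
      refine (norm_add_le _ _).trans ?_
      linarith [norm_QJ_unitBall_le (X := X)]
    set d := ‖QJ A - QJ B‖ with hd
    refine sub_le_iff_le_add'.2
      (le_of_forall_le_add_mul (c := (1 - d) * μ ((1 + r) • unitBall X)) fun t ht ht1 => ?_)
    have hd0 : 0 ≤ d := norm_nonneg _
    -- The excess t(1 - d) keeps the parameter d + t(1 - d) at most 1.
    have hdt : 0 < t * (1 - d) := mul_pos ht (sub_pos.2 h1)
    have h2 := hμ.le_of_J_le h𝒟 hA hB (d := d + t * (1 - d) / 2) (d' := d + t * (1 - d))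
      (by positivity) (by linarith) (exists_J_le_of_norm_lt hA hB (by linarith))
    have h3 := hμ.add_smul_unitBall_le hB (t := d + t * (1 - d)) (by positivity) (by nlinarith)
    have h4 : (d + t * (1 - d)) * (μ (convexHull ℝ B + unitBall X) - μ B) ≤
        (d + t * (1 - d)) * μ ((1 + r) • unitBall X) :=
      mul_le_mul_of_nonneg_left (by linarith) (by positivity)
    linarith

/-- Subadditivity and homogeneity evaluate the ball summand directly, so no bound on the norms is
needed. -/
lemma sub_le_mul_norm_of_sublinear (h𝒟 : IsFundamental 𝒟) (hμ : IsConvexMNP 𝒟 μ)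
    (hμ' : IsSublinearMNP 𝒟 μ) {A B : Set X} (hA : A ∈ BddSets X) (hB : B ∈ BddSets X) :
    μ A - μ B ≤ μ (unitBall X) * ‖QJ A - QJ B‖ := by
  refine sub_le_iff_le_add'.2
    (le_of_forall_le_add_mul (c := μ (unitBall X)) fun t ht _ => ?_)
  have h2 := hμ.le_of_J_le h𝒟 hA hB (d := ‖QJ A - QJ B‖ + t / 2) (d' := ‖QJ A - QJ B‖ + t)
    (by positivity) (by linarith) (exists_J_le_of_norm_lt hA hB (by linarith))
  have h3 := hμ'.subadd _ (convexHull_mem_BddSets hB) _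
    (smul_mem_BddSets unitBall_mem_BddSets (‖QJ A - QJ B‖ + t))
  rw [hμ'.pos_hom _ unitBall_mem_BddSets _ (by positivity), hμ.convexHull_eq B hB] at h3
  linarith

end IsConvexMNP

end Measures

/-! ### The order isometry and the cone of bounded sets -/

section Representation

variable {X : Type u} [NormedAddCommGroup X] [NormedSpace ℝ X]

lemma exists_isOrderIsometry (X : Type u) [NormedAddCommGroup X] [NormedSpace ℝ X] :
    ∃ (K : Type u) (_ : TopologicalSpace K) (_ : CompactSpace K) (_ : T2Space K)
      (T : QuotientSpace X →ₗᵢ[ℝ] C(K, ℝ)), IsOrderIsometry T := by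
  have hE : ∀ x ∈ spaceC X, |x| ∈ spaceC X := fun x hx => abs_mem_spaceC hx
  have hI := (isClosedIdeal_idealK (X := X)).solid
  -- Closedness makes the quotient seminorm a norm, as injectivity of the isometry requires.
  have : IsClosed (idealK X : Set (spaceC X)) := isClosedIdeal_idealK.closed
  refine ⟨annChars (idealK X), inferInstance, inferInstance, inferInstance,
    gelfandIsometry hE hI, ?_⟩
  have habs : ∀ p : QuotientSpace X, ∃ s, gelfandIsometry hE hI s = |gelfandIsometry hE hI p| := by
    intro p
    obtain ⟨x, rfl⟩ := Submodule.Quotient.mk_surjective _ p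
    exact ⟨_, gelfandQuot_mk_abs hE x⟩
  refine ⟨fun q => ⟨fun hq => ?_, ?_⟩, fun p q => ?_, fun p q => ?_⟩
  · obtain ⟨x, rfl⟩ := Submodule.Quotient.mk_surjective _ q
    -- If the image of x is nonnegative, |x| has the same image, hence the same class.
    refine ⟨⟨|x.1|, hE _ x.2⟩, abs_nonneg x.1, (gelfandIsometry hE hI).injective ?_⟩
    exact (gelfandQuot_mk_abs hE x).trans (abs_of_nonneg hq)
  · rintro ⟨x, hx, rfl⟩ φ
    have hx' : |x.1| = x.1 := abs_of_nonneg hx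
    have := φ.2.1.2.2.1 x
    rw [hx'] at this
    exact (abs_nonneg _).trans_eq this.symm
  · obtain ⟨s, hs⟩ := habs (p - q)
    refine ⟨(2⁻¹ : ℝ) • (p + q + s), ?_⟩
    rw [map_smul, map_add, map_add, hs, map_sub]
    ext φ
    change 2⁻¹ * (gelfandIsometry hE hI p φ + gelfandIsometry hE hI q φ +
      |gelfandIsometry hE hI p φ - gelfandIsometry hE hI q φ|) = max _ _
    rcases le_total (gelfandIsometry hE hI p φ) (gelfandIsometry hE hI q φ) with h | h
    · rw [max_eq_right h, abs_of_nonpos (by linarith)]; ring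
    · rw [max_eq_left h, abs_of_nonneg (by linarith)]; ring
  · obtain ⟨s, hs⟩ := habs (p - q)
    refine ⟨(2⁻¹ : ℝ) • (p + q - s), ?_⟩
    rw [map_smul, map_sub, map_add, hs, map_sub]
    ext φ
    change 2⁻¹ * (gelfandIsometry hE hI p φ + gelfandIsometry hE hI q φ -
      |gelfandIsometry hE hI p φ - gelfandIsometry hE hI q φ|) = min _ _
    rcases le_total (gelfandIsometry hE hI p φ) (gelfandIsometry hE hI q φ) with h | h
    · rw [min_eq_left h, abs_of_nonpos (by linarith)]; ring
    · rw [min_eq_right h, abs_of_nonneg (by linarith)]; ring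

variable {K : Type u} [TopologicalSpace K] [CompactSpace K] (T : QuotientSpace X →ₗᵢ[ℝ] C(K, ℝ))

lemma embT_add {A B : Set X} (hA : A ∈ BddSets X) (hB : B ∈ BddSets X) :
    embT T (A + B) = embT T A + embT T B := by
  rw [embT, QJ_add hA hB, map_add]
  rfl

lemma embT_smul {A : Set X} (hA : A ∈ BddSets X) {k : ℝ} (hk : 0 ≤ k) :
    embT T (k • A) = k • embT T A := by
  rw [embT, QJ_smul hA hk, map_smul]
  rfl

lemma norm_embT (A : Set X) : ‖embT T A‖ = ‖QJ A‖ := T.norm_map _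

lemma norm_embT_sub (A B : Set X) : ‖embT T A - embT T B‖ = ‖QJ A - QJ B‖ := by
  rw [embT, embT, ← map_sub, T.norm_map]

variable {T}

/-- Subtracting the support function of a point of A leaves the class unchanged, as points are
compact, and makes the representative nonnegative. -/
lemma embT_nonneg (hT : IsOrderIsometry T) {A : Set X} (hA : A ∈ BddSets X) : 0 ≤ embT T A := by
  obtain ⟨a, ha⟩ := hA.1
  refine (hT.nonneg_iff _).2 ⟨⟨J A, J_mem_spaceC hA⟩ - ⟨J {a}, J_mem_spaceC
    (singleton_mem_BddSets a)⟩, fun ω => ?_, ?_⟩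
  · exact sub_nonneg.2 (J_mono (singleton_mem_BddSets a) hA (Set.singleton_subset_iff.2 ha) ω)
  · rw [Submodule.Quotient.mk_sub, ← QJ_eq hA, ← QJ_eq (singleton_mem_BddSets a), QJ_singleton,
      sub_zero]

lemma IsConvexMNP.le_of_embT_le (hT : IsOrderIsometry T) {𝒟 : Set (Set X)}
    (h𝒟 : IsFundamental 𝒟) {μ : Set X → ℝ} (hμ : IsConvexMNP 𝒟 μ) {A B : Set X}
    (hA : A ∈ BddSets X) (hB : B ∈ BddSets X) (h : embT T A ≤ embT T B) : μ A ≤ μ B := by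
  refine hμ.le_of_nonneg h𝒟 hA hB ((hT.nonneg_iff _).1 ?_)
  rw [map_sub]
  exact sub_nonneg.2 h

end Representation

end NonProperty

end

open NonProperty in
theorem theorem6p5 (X : Type u) [NormedAddCommGroup X] [NormedSpace ℝ X] [CompleteSpace X] :
    ∃ (K : Type u) (_ : TopologicalSpace K) (_ : CompactSpace K) (_ : T2Space K)
      (T : QuotientSpace X →ₗᵢ[ℝ] C(K, ℝ)),
      IsOrderIsometry T ∧
      -- the image `V` is a convex cone of nonnegative functions
      (∀ f ∈ coneV T, 0 ≤ f) ∧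
      (∀ f ∈ coneV T, ∀ g ∈ coneV T, f + g ∈ coneV T) ∧
      (∀ f ∈ coneV T, ∀ k : ℝ, 0 ≤ k → k • f ∈ coneV T) ∧
      ∀ 𝒟 : Set (Set X), IsFundamental 𝒟 → ∀ μ : Set X → ℝ, IsConvexMNP 𝒟 μ →
        ∃ F : C(K, ℝ) → ℝ,
          (∀ B ∈ BddSets X, μ B = F (embT T B)) ∧
          ((∀ f ∈ coneV T, 0 ≤ F f) ∧ ConvexOn ℝ (coneV T) F ∧ MonotoneOn F (coneV T)) ∧
          (∀ r : ℝ, 0 ≤ r → ∀ f ∈ coneV T ∩ Metric.closedBall 0 r,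
            F f ≤ F (r • embT T (unitBall X))) ∧
          (∀ r : ℝ, 0 ≤ r →
            F ((1 + r) • embT T (unitBall X)) = μ ((1 + r) • unitBall X) ∧
            ∀ f ∈ coneV T ∩ Metric.closedBall 0 r, ∀ g ∈ coneV T ∩ Metric.closedBall 0 r,
              |F f - F g| ≤ F ((1 + r) • embT T (unitBall X)) * ‖f - g‖) ∧
          (IsSublinearMNP 𝒟 μ → ∀ r : ℝ, 0 ≤ r →
            ∀ f ∈ coneV T ∩ Metric.closedBall 0 r, ∀ g ∈ coneV T ∩ Metric.closedBall 0 r,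
              |F f - F g| ≤ μ (unitBall X) * ‖f - g‖) := by
  obtain ⟨K, i1, i2, i3, T, hT⟩ := exists_isOrderIsometry X
  have hadd : ∀ f ∈ coneV T, ∀ g ∈ coneV T, f + g ∈ coneV T := by
    rintro _ ⟨A, hA, rfl⟩ _ ⟨B, hB, rfl⟩
    exact ⟨A + B, add_mem_BddSets hA hB, embT_add T hA hB⟩
  have hsmul : ∀ f ∈ coneV T, ∀ k : ℝ, 0 ≤ k → k • f ∈ coneV T := by
    rintro _ ⟨A, hA, rfl⟩ k hk
    exact ⟨k • A, smul_mem_BddSets hA k, embT_smul T hA hk⟩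
  refine ⟨K, i1, i2, i3, T, hT, ?_, hadd, hsmul, fun 𝒟 h𝒟 μ hμ => ?_⟩
  · rintro _ ⟨A, hA, rfl⟩
    exact embT_nonneg hT hA
  classical
  -- The chosen preimage is immaterial: sets with equal images have equal measure, by monotonicity
  -- both ways. The value 0 off the cone plays no role.
  let F : C(K, ℝ) → ℝ := fun f => if h : f ∈ coneV T then μ h.choose else 0
  have hF : ∀ B ∈ BddSets X, F (embT T B) = μ B := fun B hB => by
    have h : embT T B ∈ coneV T := ⟨B, hB, rfl⟩
    have hc := h.choose_spec
    simp only [F, dif_pos h]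
    exact le_antisymm (hμ.le_of_embT_le hT h𝒟 hc.1 hB hc.2.le)
      (hμ.le_of_embT_le hT h𝒟 hB hc.1 hc.2.ge)
  have hFball : ∀ r : ℝ, 0 ≤ r → F (r • embT T (unitBall X)) = μ (r • unitBall X) := fun r hr => by
    rw [← embT_smul T unitBall_mem_BddSets hr, hF _ (smul_mem_BddSets unitBall_mem_BddSets r)]
  have hnorm : ∀ {A : Set X} {r : ℝ}, embT T A ∈ Metric.closedBall 0 r → ‖QJ A‖ ≤ r :=
    fun {A r} h => (norm_embT T A).symm.trans_le (mem_closedBall_zero_iff.1 h)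
  refine ⟨F, fun B hB => (hF B hB).symm, ⟨?_, ⟨?_, ?_⟩, ?_⟩, ?_,
    fun r hr => ⟨hFball _ (by positivity), ?_⟩,
    fun hμ' r hr => ?_⟩
  · rintro _ ⟨A, hA, rfl⟩
    rw [hF A hA]
    exact hμ.nonneg A hA
  · exact fun f hf g hg a b ha hb _ => hadd _ (hsmul f hf a ha) _ (hsmul g hg b hb)
  · rintro _ ⟨A, hA, rfl⟩ _ ⟨B, hB, rfl⟩ a b ha hb hab
    obtain rfl : b = 1 - a := by linarith
    have hA' := smul_mem_BddSets hA a
    have hB' := smul_mem_BddSets hB (1 - a)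
    rw [← embT_smul T hA ha, ← embT_smul T hB hb, ← embT_add T hA' hB',
      hF _ (add_mem_BddSets hA' hB'), hF A hA, hF B hB]
    exact hμ.convex A hA B hB a ha (by linarith)
  · rintro _ ⟨A, hA, rfl⟩ _ ⟨B, hB, rfl⟩ h
    rw [hF A hA, hF B hB]
    exact hμ.le_of_embT_le hT h𝒟 hA hB h
  · rintro r hr _ ⟨⟨A, hA, rfl⟩, hAr⟩
    rw [hF A hA, hFball r hr]
    exact hμ.le_smul_unitBall h𝒟 hA (hnorm hAr)
  · rintro _ ⟨⟨A, hA, rfl⟩, hAr⟩ _ ⟨⟨B, hB, rfl⟩, hBr⟩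
    rw [hF A hA, hF B hB, hFball _ (by positivity), norm_embT_sub]
    refine abs_sub_le_iff.2 ⟨hμ.sub_le_mul_norm h𝒟 hA hB (hnorm hAr) (hnorm hBr), ?_⟩
    rw [norm_sub_rev]
    exact hμ.sub_le_mul_norm h𝒟 hB hA (hnorm hBr) (hnorm hAr)
  · rintro _ ⟨⟨A, hA, rfl⟩, -⟩ _ ⟨⟨B, hB, rfl⟩, -⟩
    rw [hF A hA, hF B hB, norm_embT_sub]
    refine abs_sub_le_iff.2 ⟨hμ.sub_le_mul_norm_of_sublinear h𝒟 hμ' hA hB, ?_⟩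
    rw [norm_sub_rev]
    exact hμ.sub_le_mul_norm_of_sublinear h𝒟 hμ' hB hA
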